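/- For $l \ge 1$ let $P_l$ denote the path with $l$ vertices, and for $m \ge 3$ let $C_m$ denote the cycle with $m$ vertices. For graphs $H$ and $F$ let $ex(n,H,F)$ be the maximum, over all $n$-vertex simple graphs $G$ that contain no (not necessarily induced) subgraph isomorphic to $F$, of the number of subgraphs of $G$ isomorphic to $H$. **Theorem.** For all fixed integers $l, k \ge 2$, $$ex(n, P_l, C_{2k}) \le (1+o(1))\, \frac{1}{2}\,(k-1)^{\frac{l-1}{2}}\, n^{\frac{l+1}{2}},$$ where $o(1)$ denotes a quantity, depending on $l$, $k$ and $n$, that tends to $0$ as $n \to \infty$. -/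

import Mathlib

open scoped Classical in
/-- The generalized Turán number `ex(n, H, F)`: the maximum number of copies of `H` (that is, of
subgraphs isomorphic to `H`, see `SimpleGraph.copyCount`) in an `F`-free graph on `n` vertices. Here
`F`-free means that no subgraph, induced or not, is isomorphic to `F`. The value is `0` if there is
no `F`-free graph on `n` vertices. -/
noncomputable def generalizedTuranNumber (n : ℕ) {U W : Type*}
    (H : SimpleGraph U) (F : SimpleGraph W) : ℕ :=
  Finset.sup {G : SimpleGraph (Fin n) | F.Free G} (fun G => G.copyCount H)

/-! In a `C_{2k}`-free graph, a dense pair formed by part of `N(v)` and another vertex set avoiding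
`v` has a subpair of large minimum degree. A greedy path of length `2k - 2` there, with both ends in
`N(v)`, closes up through `v`. Hence at most `(k - 1) n + c d(v)` walks of length two start at `v`
(`sum_degree_neighborFinset_le`). So the numbers `W_j` of walks of length `j` satisfy `W_{j+2} ≤ (k
- 1) n W_j + c W_{j+1}`, and `W_j ≤ n r ^ j` for the positive root `r ~ √((k - 1) n)` of the
characteristic equation. Each path is two walks, which gives the factor `1/2`. -/

open Finset SimpleGraph

namespace SimpleGraph

variable {V : Type*}

/-! ### Walks of length two from a fixed vertex -/

section LocalBound

open scoped Classical

/-- If every pair of nonempty subsets has a vertex of small degree into the other side, then the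
number of adjacent pairs is linear in the sizes. -/
theorem sum_card_filter_adj_le_of_degenerate (G : SimpleGraph V) (p q : ℕ) (A B : Finset V)
    (H : ∀ A' ⊆ A, ∀ B' ⊆ B, (A' ∪ B').Nonempty →
      (∃ a ∈ A', #{b ∈ B' | G.Adj a b} ≤ p) ∨ (∃ b ∈ B', #{a ∈ A' | G.Adj b a} ≤ q)) :
    ∑ a ∈ A, #{b ∈ B | G.Adj a b} ≤ p * #A + q * #B := by
  have swap : ∀ S T : Finset V,
      ∑ a ∈ S, #{b ∈ T | G.Adj a b} = ∑ b ∈ T, #{a ∈ S | G.Adj b a} := by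
    intro S T
    have := Finset.sum_card_bipartiteAbove_eq_sum_card_bipartiteBelow (s := S) (t := T) G.Adj
    simp only [bipartiteAbove, bipartiteBelow] at this
    rw [this]
    simp only [G.adj_comm]
  induction h : #A + #B generalizing A B with
  | zero =>
    have : A = ∅ := by rw [← card_eq_zero]; omega
    simp [this]
  | succ N ih =>
    have hne : (A ∪ B).Nonempty := by
      rw [nonempty_iff_ne_empty, ne_eq, union_eq_empty]
      rintro ⟨rfl, rfl⟩
      simp at h
    rcases H A subset_rfl B subset_rfl hne with ⟨a, ha, hd⟩ | ⟨b, hb, hd⟩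
    · have hc := card_erase_add_one ha
      have := ih (A.erase a) B
        (fun A' hA' B' hB' => H A' (hA'.trans (erase_subset _ _)) B' hB') (by omega)
      rw [← add_sum_erase A _ ha, ← hc, mul_add]
      omega
    · have hc := card_erase_add_one hb
      have := ih A (B.erase b)
        (fun A' hA' B' hB' => H A' hA' B' (hB'.trans (erase_subset _ _))) (by omega)
      rw [swap] at this ⊢
      rw [← add_sum_erase B _ hb, ← hc, mul_add]
      omega

/-- A greedily constructed path of length `2 * m` alternating between `A` and `B`. -/
theorem exists_alternating_path (G : SimpleGraph V) {p q M : ℕ} {A B : Finset V}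
    (hne : (A ∪ B).Nonempty)
    (hA : ∀ a ∈ A, p < #{b ∈ B | G.Adj a b}) (hB : ∀ b ∈ B, q < #{a ∈ A | G.Adj b a})
    (hM : (2 * M ≤ p ∧ 2 * M ≤ q) ∨ (Disjoint A B ∧ M ≤ p ∧ M ≤ q)) (m : ℕ) (hm : m ≤ M) :
    ∃ x ∈ A, ∃ y ∈ A, ∃ w : G.Walk x y, w.IsPath ∧ w.length = 2 * m ∧
      (∀ z ∈ w.support, z ∈ A ∪ B) ∧
      (Disjoint A B → #(w.support.toFinset ∩ A) ≤ m + 1 ∧ #(w.support.toFinset ∩ B) ≤ m) := by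
  induction m with
  | zero =>
    have : A.Nonempty := by
      obtain ⟨z, hz⟩ := hne
      rcases mem_union.1 hz with hz | hz
      · exact ⟨z, hz⟩
      · obtain ⟨a, ha⟩ := card_pos.1 (pos_of_gt (hB z hz))
        exact ⟨a, (mem_filter.1 ha).1⟩
    obtain ⟨x, hx⟩ := this
    refine ⟨x, hx, x, hx, .nil, by simp, by simp, by simp [hx], fun hd => ⟨?_, ?_⟩⟩
    · simpa using (card_le_card (inter_subset_left (s₁ := {x}) (s₂ := A)))
    · have : x ∉ B := Finset.disjoint_left.1 hd hx
      simp [this]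
  | succ m ih =>
    obtain ⟨x, hx, y, hy, w, hw, hl, hs, hd⟩ := ih (by omega)
    have hcard : #w.support.toFinset ≤ 2 * m + 1 := by
      simpa [hl] using List.toFinset_card_le w.support
    have newVertex : ∀ (S C D : Finset V), #(S ∩ D) < #C → C ⊆ D → ∃ c ∈ C, c ∉ S := by
      intro S C D h hCD
      by_contra! hcon
      exact absurd (card_le_card (subset_inter hcon hCD)) (by omega)
    -- If `A` and `B` are disjoint, the path has only about half its vertices on each side, so half
    -- the degree suffices. This yields the sharp constant `k - 1`.
    obtain ⟨b, hb, hbw⟩ := newVertex w.support.toFinset _ B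
      (lt_of_le_of_lt (by
        rcases hM with h | h
        · have := card_le_card (inter_subset_left (s₁ := w.support.toFinset) (s₂ := B)); omega
        · have := (hd h.1).2; omega) (hA x hx)) (filter_subset _ _)
    rw [mem_filter] at hb
    rw [List.mem_toFinset] at hbw
    obtain ⟨a, ha, haw⟩ := newVertex (insert b w.support.toFinset) _ A
      (lt_of_le_of_lt (by
        rcases hM with h | h
        · have := card_le_card (inter_subset_left (s₁ := insert b w.support.toFinset) (s₂ := A))
          have := card_insert_le b w.support.toFinset
          omega
        · have := (hd h.1).1
          rw [insert_inter_of_notMem (Finset.disjoint_right.1 h.1 hb.1)]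
          omega) (hB b hb.1)) (filter_subset _ _)
    rw [mem_filter] at ha
    simp only [mem_insert, List.mem_toFinset, not_or] at haw
    refine ⟨a, ha.1, y, hy, .cons ha.2.symm (.cons hb.2.symm w), ?_, ?_, ?_, fun hdis => ?_⟩
    · simp [Walk.cons_isPath_iff, hw, hbw, haw]
    · simp [hl]; ring
    · intro z hz
      simp only [Walk.support_cons, List.mem_cons] at hz
      rcases hz with rfl | rfl | hz
      · exact mem_union_left _ ha.1
      · exact mem_union_right _ hb.1
      · exact hs z hz
    · have h1 := hd hdis
      simp only [Walk.support_cons, List.toFinset_cons]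
      rw [insert_inter_of_mem ha.1, insert_inter_of_notMem (Finset.disjoint_right.1 hdis hb.1),
        insert_inter_of_notMem (Finset.disjoint_left.1 hdis ha.1), insert_inter_of_mem hb.1]
      exact ⟨(card_insert_le _ _).trans (by omega), (card_insert_le _ _).trans (by omega)⟩

/-- A path of length `2 * k - 2` between two neighbours of a vertex `v` off the path closes up to a
cycle of length `2 * k`. -/
theorem cycleGraph_isContained_of_path {G : SimpleGraph V} {k : ℕ} (hk : 2 ≤ k) {v x y : V}
    (hx : G.Adj v x) (hy : G.Adj v y) (w : G.Walk x y) (hw : w.IsPath)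
    (hl : w.length = 2 * (k - 1)) (hv : v ∉ w.support) : cycleGraph (2 * k) ⊑ G := by
  rw [cycleGraph_isContained_iff (by omega)]
  refine ⟨v, .cons hx (w.concat hy.symm), ?_, ?_⟩
  · rw [Walk.cons_isCycle_iff]
    refine ⟨hw.concat hv hy.symm, ?_⟩
    rw [Walk.edges_concat]
    simp only [List.concat_eq_append, List.mem_append, List.mem_singleton, not_or]
    refine ⟨fun h => hv (w.fst_mem_support_of_mem_edges h), fun h => ?_⟩
    have hxy : x = y := by
      rw [Sym2.eq_swap, Sym2.congr_left] at h
      exact h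
    subst hxy
    rw [Walk.isPath_iff_nil] at hw
    rw [hw.length_eq_zero] at hl
    omega
  · simp [hl]; omega

/-- The number of adjacent pairs between a subset of the neighbourhood of `v` and another set, in a
graph without cycles of length `2 * k`. -/
theorem sum_card_filter_adj_le_of_free {G : SimpleGraph V} {k p : ℕ} (hk : 2 ≤ k)
    (hG : (cycleGraph (2 * k)).Free G) {v : V} {A B : Finset V} (hA : ∀ a ∈ A, G.Adj v a)
    (hv : v ∉ B) (hp : 2 * (k - 1) ≤ p ∨ (Disjoint A B ∧ k - 1 ≤ p)) :
    ∑ a ∈ A, #{b ∈ B | G.Adj a b} ≤ p * #A + p * #B := by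
  refine sum_card_filter_adj_le_of_degenerate G p p A B fun A' hA' B' hB' hne => ?_
  by_contra! hcon
  obtain ⟨x, hx, y, hy, w, hw, hl, hs, -⟩ := exists_alternating_path G (M := k - 1) hne hcon.1
    hcon.2 (hp.imp (fun h => ⟨h, h⟩)
      fun h => ⟨disjoint_of_subset_left hA' (disjoint_of_subset_right hB' h.1), h.2, h.2⟩)
    (k - 1) le_rfl
  refine hG (cycleGraph_isContained_of_path hk (hA x (hA' hx)) (hA y (hA' hy)) w hw hl
    fun hvw => ?_)
  rcases mem_union.1 (hs v hvw) with h | h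
  · exact G.irrefl (hA v (hA' h))
  · exact hv (hB' h)

/-- In a graph without cycles of length `2 * k`, the number of walks of length two starting at `v`
is at most `(k - 1) n` up to a constant multiple of the degree of `v`. -/
theorem sum_degree_neighborFinset_le [Fintype V] {G : SimpleGraph V} {k : ℕ} (hk : 2 ≤ k)
    (hG : (cycleGraph (2 * k)).Free G) (v : V) :
    ∑ u ∈ G.neighborFinset v, G.degree u ≤
      (k - 1) * Fintype.card V + (5 * (k - 1) + 1) * G.degree v := by
  set A := G.neighborFinset v with hAdef
  set B := (univ \ A).erase v with hBdef
  have hA : ∀ a ∈ A, G.Adj v a := fun a ha => by simpa [hAdef] using ha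
  -- The weaker constant is harmless here: both sides have size `d(v)`, so only the lower-order term
  -- is affected.
  have h1 := sum_card_filter_adj_le_of_free (p := 2 * (k - 1)) (A := A) (B := A) hk hG hA
    (by simp [hAdef]) (.inl le_rfl)
  have hdis : Disjoint A B := disjoint_of_subset_right (erase_subset _ _) disjoint_sdiff
  have h2 := sum_card_filter_adj_le_of_free (p := k - 1) (A := A) (B := B) hk hG hA
    (by simp [hBdef]) (.inr ⟨hdis, le_rfl⟩)
  have hdeg : ∀ u, G.degree u ≤ #{b ∈ A | G.Adj u b} + #{b ∈ B | G.Adj u b} + 1 := by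
    intro u
    rw [← card_neighborFinset_eq_degree, ← card_singleton v]
    refine (card_le_card fun z hz => ?_).trans
      ((card_union_le _ _).trans (Nat.add_le_add_right (card_union_le _ _) _))
    have hz : G.Adj u z := by simpa using hz
    by_cases hzA : z ∈ A
    · simp [hzA, hz]
    · by_cases hzv : z = v <;> simp [hBdef, hzA, hz, hzv]
  have hB : #B ≤ Fintype.card V := card_le_univ _
  have hAc : #A = G.degree v := card_neighborFinset_eq_degree G v
  calc ∑ u ∈ A, G.degree u
      ≤ ∑ u ∈ A, (#{b ∈ A | G.Adj u b} + #{b ∈ B | G.Adj u b} + 1) := sum_le_sum fun u _ => hdeg u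
    _ = ∑ u ∈ A, #{b ∈ A | G.Adj u b} + ∑ u ∈ A, #{b ∈ B | G.Adj u b} + #A := by
        simp [sum_add_distrib]
    _ ≤ _ := by
        have := Nat.mul_le_mul_left (k - 1) hB
        rw [hAc] at h1 h2 ⊢
        linarith

end LocalBound

/-! ### Counting walks and paths -/

section WalkCount

variable [Fintype V] (G : SimpleGraph V) [DecidableRel G.Adj]

/-- The number of walks of length `j` starting at `v`. -/
def walkCount : ℕ → V → ℕ
  | 0, _ => 1
  | j + 1, v => ∑ u ∈ G.neighborFinset v, walkCount j u

theorem sum_neighborFinset_comm (f g : V → ℕ) :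
    ∑ v, g v * ∑ u ∈ G.neighborFinset v, f u = ∑ u, f u * ∑ v ∈ G.neighborFinset u, g v := by
  simp only [mul_sum, neighborFinset_eq_filter, sum_filter]
  rw [sum_comm]
  refine sum_congr rfl fun x _ => sum_congr rfl fun y _ => ?_
  by_cases h : G.Adj x y <;> simp [h, G.adj_comm y x, mul_comm]

theorem sum_walkCount_succ (j : ℕ) :
    ∑ v, G.walkCount (j + 1) v = ∑ v, G.walkCount j v * G.degree v := by
  have := G.sum_neighborFinset_comm (G.walkCount j) (fun _ => 1)
  simpa [walkCount] using this

theorem sum_walkCount_add_two (j : ℕ) :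
    ∑ v, G.walkCount (j + 2) v =
      ∑ v, G.walkCount j v * ∑ u ∈ G.neighborFinset v, G.degree u := by
  rw [sum_walkCount_succ, ← sum_neighborFinset_comm]
  simp [walkCount, mul_comm]

theorem sum_walkCount_add_two_le {a c : ℕ}
    (h : ∀ v, ∑ u ∈ G.neighborFinset v, G.degree u ≤ a + c * G.degree v) (j : ℕ) :
    ∑ v, G.walkCount (j + 2) v ≤
      a * ∑ v, G.walkCount j v + c * ∑ v, G.walkCount (j + 1) v := by
  rw [sum_walkCount_add_two, sum_walkCount_succ, mul_sum, mul_sum, ← sum_add_distrib]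
  refine sum_le_sum fun v _ => (Nat.mul_le_mul_left _ (h v)).trans_eq ?_
  ring

theorem sum_walkCount_one_sq_le :
    (∑ v, G.walkCount 1 v) ^ 2 ≤ Fintype.card V * ∑ v, G.walkCount 2 v := by
  have h1 : ∑ v, G.walkCount 1 v = ∑ v, G.degree v := by simp [walkCount]
  have h2 : ∑ v, G.walkCount 2 v = ∑ v, G.degree v ^ 2 := by
    rw [sum_walkCount_succ]
    simp [walkCount, sq]
  rw [h1, h2]
  exact sq_sum_le_card_mul_sum_sq

/-- Induction on the two-step recurrence. The case `j = 1` comes from Cauchy–Schwarz: `T = W_1`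
satisfies `T² ≤ N (a N + c T)`, a quadratic inequality whose positive root is `N r`. -/
theorem sum_walkCount_le_mul_pow {a c : ℕ}
    (h : ∀ v, ∑ u ∈ G.neighborFinset v, G.degree u ≤ a + c * G.degree v) {r : ℝ} (hr : 0 < r)
    (hroot : r ^ 2 = a + c * r) (j : ℕ) :
    ((∑ v, G.walkCount j v : ℕ) : ℝ) ≤ Fintype.card V * r ^ j := by
  have h0 : ∑ v, G.walkCount 0 v = Fintype.card V := by simp [walkCount]
  have recur (j : ℕ) : ((∑ v, G.walkCount (j + 2) v : ℕ) : ℝ) ≤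
      a * (∑ v, G.walkCount j v : ℕ) + c * (∑ v, G.walkCount (j + 1) v : ℕ) := by
    exact_mod_cast G.sum_walkCount_add_two_le h j
  have hN : (0 : ℝ) ≤ Fintype.card V := Nat.cast_nonneg _
  have h1 : ((∑ v, G.walkCount 1 v : ℕ) : ℝ) ≤ Fintype.card V * r := by
    have hcs : ((∑ v, G.walkCount 1 v : ℕ) : ℝ) ^ 2 ≤
        Fintype.card V * (∑ v, G.walkCount 2 v : ℕ) := by
      exact_mod_cast G.sum_walkCount_one_sq_le
    have h2 := recur 0
    rw [h0] at h2
    simp only [zero_add] at h2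
    set T := ((∑ v, G.walkCount 1 v : ℕ) : ℝ)
    set N := (Fintype.card V : ℝ)
    have hT : T ^ 2 ≤ N * (a * N + c * T) := hcs.trans (mul_le_mul_of_nonneg_left h2 hN)
    by_contra! hlt
    have hcr : (c : ℝ) ≤ r := by
      have : (0 : ℝ) ≤ a := Nat.cast_nonneg _
      nlinarith
    have hprod : 0 < (T - N * r) * (T + N * (r - c)) := by
      refine mul_pos (by linarith) ?_
      have : 0 ≤ N * r := by positivity
      have : 0 ≤ N * (r - c) := mul_nonneg hN (by linarith)
      linarith
    have : (T - N * r) * (T + N * (r - c)) = T ^ 2 - N * (a * N + c * T) := by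
      linear_combination (-N ^ 2) * hroot
    linarith
  induction j using Nat.twoStepInduction with
  | zero => simp [h0]
  | one => simpa using h1
  | more j ih1 ih2 =>
    calc ((∑ v, G.walkCount (j + 2) v : ℕ) : ℝ)
        ≤ a * (∑ v, G.walkCount j v : ℕ) + c * (∑ v, G.walkCount (j + 1) v : ℕ) := recur j
      _ ≤ a * (Fintype.card V * r ^ j) + c * (Fintype.card V * r ^ (j + 1)) := by gcongr
      _ = Fintype.card V * r ^ (j + 2) := by
        linear_combination (-(Fintype.card V : ℝ) * r ^ j) * hroot

open scoped Classical in
theorem card_filter_adj_le_walkCount (j : ℕ) (v : V) :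
    #{f : Fin (j + 1) → V | (∀ i : Fin j, G.Adj (f i.castSucc) (f i.succ)) ∧ f 0 = v} ≤
      G.walkCount j v := by
  induction j generalizing v with
  | zero =>
    rw [walkCount, card_le_one]
    intro f hf g hg
    simp only [mem_filter, mem_univ, true_and] at hf hg
    ext i
    rw [Fin.fin_one_eq_zero i, hf.2, hg.2]
  | succ j ih =>
    rw [walkCount]
    refine (card_le_card_of_injOn Fin.tail (t := (G.neighborFinset v).biUnion fun u =>
      {f : Fin (j + 1) → V | (∀ i : Fin j, G.Adj (f i.castSucc) (f i.succ)) ∧ f 0 = u})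
      ?_ ?_).trans (card_biUnion_le.trans (sum_le_sum fun u _ => ih u))
    · intro f hf
      simp only [coe_filter, mem_univ, true_and, Set.mem_ofPred_eq] at hf
      simp only [mem_coe, mem_biUnion, mem_filter, mem_univ, true_and, mem_neighborFinset]
      refine ⟨f 1, ?_, fun i => ?_, rfl⟩
      · have := hf.1 0
        rw [← hf.2]
        simpa using this
      · exact hf.1 i.succ
    · intro f hf g hg hfg
      simp only [coe_filter, mem_univ, true_and, Set.mem_ofPred_eq] at hf hg
      rw [← Fin.cons_self_tail f, ← Fin.cons_self_tail g, hfg, hf.2, hg.2]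

open scoped Classical in
theorem card_copy_pathGraph_le (j : ℕ) :
    Fintype.card (Copy (pathGraph (j + 1)) G) ≤ ∑ v, G.walkCount j v := by
  rw [← card_univ]
  refine (card_le_card_of_injOn (fun e : Copy (pathGraph (j + 1)) G => (e : Fin (j + 1) → V))
    (t := univ.biUnion fun v => {f : Fin (j + 1) → V |
      (∀ i : Fin j, G.Adj (f i.castSucc) (f i.succ)) ∧ f 0 = v}) ?_ ?_).trans
    (card_biUnion_le.trans (sum_le_sum fun v _ => G.card_filter_adj_le_walkCount j v))
  · intro e _
    simp only [mem_coe, mem_biUnion, mem_filter, mem_univ, true_and]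
    refine ⟨e 0, fun i => e.toHom.map_adj ?_, rfl⟩
    simp [pathGraph_adj]
  · intro e _ e' _ h
    exact DFunLike.coe_injective h

/-- The order reversing automorphism of a path. -/
def pathGraphRev (l : ℕ) : pathGraph l ≃g pathGraph l where
  toEquiv := Fin.revPerm
  map_rel_iff' := by
    intro a b
    simp only [pathGraph_adj, Fin.revPerm_apply, Fin.val_rev]
    omega

open scoped Classical in
/-- Every path with at least two vertices is traversed in two directions. -/
theorem two_mul_copyCount_pathGraph_le {l : ℕ} (hl : 2 ≤ l) :
    2 * G.copyCount (pathGraph l) ≤ Fintype.card (Copy (pathGraph l) G) := by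
  rw [copyCount_eq_card_image_copyToSubgraph, ← card_univ]
  refine mul_card_image_le_card _ 2 fun S hS => ?_
  obtain ⟨e, -, rfl⟩ := mem_image.1 hS
  have hne : e ≠ e.comp (pathGraphRev l).toCopy := by
    intro h
    have h0 := e.injective (DFunLike.congr_fun h (⟨0, by omega⟩ : Fin l))
    have h1 : (0 : ℕ) = l - (0 + 1) := congrArg Fin.val h0
    omega
  rw [← card_pair hne]
  refine card_le_card fun x hx => ?_
  rw [mem_filter]
  refine ⟨mem_univ _, ?_⟩
  rcases mem_insert.1 hx with rfl | hx
  · rfl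
  · rw [mem_singleton.1 hx]
    have h : Subgraph.map (pathGraphRev l).toCopy.toHom ⊤ = ⊤ :=
      Subgraph.map_iso_top (pathGraphRev l)
    have h' : (e.comp (pathGraphRev l).toCopy).toHom =
      e.toHom.comp (pathGraphRev l).toCopy.toHom := rfl
    rw [Copy.toSubgraph, h', Subgraph.map_comp, h]

theorem two_mul_copyCount_pathGraph_le_mul_pow {l k : ℕ} (hl : 2 ≤ l) (hk : 2 ≤ k)
    (hG : (cycleGraph (2 * k)).Free G) {r : ℝ} (hr : 0 < r)
    (hroot : r ^ 2 = ((k - 1) * Fintype.card V : ℕ) + (5 * (k - 1) + 1 : ℕ) * r) :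
    2 * (G.copyCount (pathGraph l) : ℝ) ≤ Fintype.card V * r ^ (l - 1) := by
  classical
  obtain ⟨j, rfl⟩ : ∃ j, l = j + 1 := ⟨l - 1, by omega⟩
  refine le_trans ?_ (G.sum_walkCount_le_mul_pow (fun v => ?_) hr hroot j)
  · exact_mod_cast (G.two_mul_copyCount_pathGraph_le hl).trans (G.card_copy_pathGraph_le j)
  · convert sum_degree_neighborFinset_le hk hG v

end WalkCount

end SimpleGraph

/-! ### Asymptotics of the characteristic root -/

theorem theorem2p11 (l k : ℕ) (hl : 2 ≤ l) (hk : 2 ≤ k) :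
    ∃ ε : ℕ → ℝ, Filter.Tendsto ε Filter.atTop (nhds 0) ∧
      ∀ n : ℕ,
        (generalizedTuranNumber n (SimpleGraph.pathGraph l) (SimpleGraph.cycleGraph (2 * k)) : ℝ) ≤
          (1 + ε n) * (1 / 2 * ((k : ℝ) - 1) ^ (((l : ℝ) - 1) / 2) *
            (n : ℝ) ^ (((l : ℝ) + 1) / 2)) := by
  have hk1 : (0 : ℝ) < k - 1 := by
    have : (2 : ℝ) ≤ k := by exact_mod_cast hk
    linarith
  set c : ℝ := ((5 * (k - 1) + 1 : ℕ) : ℝ) with hc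
  -- With `t = √((k - 1) n)`, the root is `r = t (s + √(s² + 1))`, so `ρ (s n)` is exactly the
  -- relative error of `r ^ (l - 1)` against `t ^ (l - 1)`.
  let s : ℕ → ℝ := fun n => c / (2 * √((k - 1) * n))
  let ρ : ℝ → ℝ := fun x => (x + √(x ^ 2 + 1)) ^ (l - 1) - 1
  have hs : Filter.Tendsto s Filter.atTop (nhds 0) := by
    refine Filter.Tendsto.const_div_atTop ?_ c
    refine Filter.Tendsto.const_mul_atTop two_pos (Real.tendsto_sqrt_atTop.comp ?_)
    exact Filter.Tendsto.const_mul_atTop hk1 tendsto_natCast_atTop_atTop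
  have hρ : Filter.Tendsto ρ (nhds 0) (nhds 0) := by
    have : Continuous ρ := by fun_prop
    simpa [ρ] using this.tendsto 0
  refine ⟨ρ ∘ s, hρ.comp hs, fun n => ?_⟩
  rcases Nat.eq_zero_or_pos n with rfl | hn
  · have h0 : generalizedTuranNumber 0 (pathGraph l) (cycleGraph (2 * k)) = 0 := by
      refine Nat.eq_zero_of_le_zero (Finset.sup_le fun G _ => ?_)
      rw [Nat.le_zero, copyCount_eq_zero]
      rintro ⟨e⟩
      exact (e ⟨0, by omega⟩).elim0
    have : ((l : ℝ) + 1) / 2 ≠ 0 := by positivity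
    simp [h0, Real.zero_rpow this]
  have hn' : (0 : ℝ) < n := by exact_mod_cast hn
  set t : ℝ := √((k - 1) * n) with ht
  have htpos : 0 < t := Real.sqrt_pos.2 (by positivity)
  have htsq : t ^ 2 = (k - 1) * n := Real.sq_sqrt (by positivity)
  set q : ℝ := √(s n ^ 2 + 1) with hq
  have hqsq : q ^ 2 = s n ^ 2 + 1 := Real.sq_sqrt (by positivity)
  have hqpos : 0 < q := Real.sqrt_pos.2 (by positivity)
  have hst : 2 * s n * t = c := by
    simp only [s, ← ht]
    field_simp
  have hspos : 0 ≤ s n := by positivity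
  have hroot : (t * (s n + q)) ^ 2 = ((k - 1) * n : ℕ) + c * (t * (s n + q)) := by
    rw [← hst]
    push_cast [Nat.cast_sub (by omega : 1 ≤ k)]
    linear_combination t ^ 2 * hqsq + htsq
  have hrhs : ((k : ℝ) - 1) ^ (((l : ℝ) - 1) / 2) * (n : ℝ) ^ (((l : ℝ) + 1) / 2) =
      n * t ^ (l - 1) := by
    have h1 : (n : ℝ) ^ (((l : ℝ) + 1) / 2) = n * (n : ℝ) ^ (((l : ℝ) - 1) / 2) := by
      rw [← Real.rpow_one_add' hn'.le]
      · congr 1; ring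
      · have : (2 : ℝ) ≤ l := by exact_mod_cast hl
        intro h; linarith
    have h2 : t ^ (l - 1) = (((k : ℝ) - 1) * n) ^ (((l : ℝ) - 1) / 2) := by
      rw [ht, Real.sqrt_eq_rpow, ← Real.rpow_natCast, ← Real.rpow_mul (by positivity)]
      congr 1
      push_cast [Nat.cast_sub (by omega : 1 ≤ l)]
      ring
    rw [h1, h2, Real.mul_rpow hk1.le hn'.le]
    ring
  have hbound : ∀ G : SimpleGraph (Fin n), (cycleGraph (2 * k)).Free G →
      (G.copyCount (pathGraph l) : ℝ) ≤ 1 / 2 * (n * (t * (s n + q)) ^ (l - 1)) := by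
    classical
    intro G hG
    have := G.two_mul_copyCount_pathGraph_le_mul_pow hl hk hG (r := t * (s n + q))
      (by positivity) (by rw [Fintype.card_fin]; exact hroot)
    rw [Fintype.card_fin] at this
    linarith
  have hfinal : (1 + (ρ ∘ s) n) * (1 / 2 * ((k : ℝ) - 1) ^ (((l : ℝ) - 1) / 2) *
      (n : ℝ) ^ (((l : ℝ) + 1) / 2)) = 1 / 2 * (n * (t * (s n + q)) ^ (l - 1)) := by
    rw [mul_assoc (1 / 2 : ℝ), hrhs]
    simp only [ρ, Function.comp_apply, ← hq, mul_pow]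
    ring
  rw [hfinal, generalizedTuranNumber]
  -- The supremum lives in `ℕ`, so the real bound is passed through its floor.
  refine (Nat.le_floor_iff (by positivity)).1 (Finset.sup_le fun G hG => ?_)
  exact Nat.le_floor (hbound G (by simpa using hG))
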